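/- Let $p$ be an odd prime and $k$ an integer with $2\le k\le \frac{p-1}{2}$ and $p\equiv 1 \pmod{2k}$, and put $N=\frac{p-1}{k}$. Let $\alpha_1,\dots,\alpha_N$ be integers, prime to $p$ and pairwise incongruent modulo $p$, each congruent modulo $p$ to a $k$-th power (so that they represent all the $k$-th power residues modulo $p$, in any order). Put $$S=S_{1+\frac{p-1}{k},k}(-1,p)=\det\big[(\alpha_i-\alpha_j)^{1+N}\big]_{1\le i,j\le N},\qquad T=\prod_{1\le i<j\le N}(\alpha_i-\alpha_j),$$ let $\left(\frac{\cdot}{p}\right)$ be the Legendre symbol, and let $a!!=a(a-2)(a-4)\cdots$ be the double factorial, where the product ends in $1$ or $2$. Then $S$ is the square of an integer, and for each integer square root $\sqrt S$ (of either sign) the following hold. (a) If $p\equiv 1\pmod{4k}$, then $$\left(\frac{\sqrt S}{p}\right)=\left(\frac{(k-1)(2k-1)}{p}\right)\left(\frac{N!!}{p}\right)\left(\frac{T}{p}\right).$$ (b) If $k$ is even and $p\equiv 2k+1\pmod{4k}$, then $$\left(\frac{\sqrt S}{p}\right)=\begin{cases}\left(\frac{T}{p}\right), & \text{if } p=2k+1,\\[4pt]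 \left(\frac{k(2k-1)}{p}\right)\left(\frac{(N-1)!!}{p}\right)\left(\frac{T}{p}\right), & \text{otherwise.}\end{cases}$$ -/

import Mathlib

open scoped Nat

/-- The integer `x` is a `k`-th residue modulo `p`: it is prime to `p` and congruent to
a `k`-th power. -/
def IsPowerResidue (p k : ℕ) (x : ℤ) : Prop :=
  ¬ (p : ℤ) ∣ x ∧ ∃ y : ℤ, y ^ k ≡ x [ZMOD p]

/-- `α 0, α 1, …` are `(p - 1) / k` integers that are `k`-th residues modulo `p` and pairwise
incongruent modulo `p`. (For `p` prime and `k ∣ p - 1` there are exactly `(p - 1) / k` classes of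
such residues, so every class is represented once.) -/
def AreDistinctPowerResidues (p k : ℕ) (α : Fin ((p - 1) / k) → ℤ) : Prop :=
  (∀ i, IsPowerResidue p k (α i)) ∧ ∀ i j, i ≠ j → ¬ α i ≡ α j [ZMOD p]

/-- The determinant `|(α_i + d α_j)^m|` over all pairs of indices. -/
def residueDet {N : ℕ} (m : ℕ) (d : ℤ) (α : Fin N → ℤ) : ℤ :=
  (Matrix.of fun i j : Fin N => (α i + d * α j) ^ m).det

/-- The product `∏_{i < j} (α_i - α_j)`. -/
def diffProd {N : ℕ} (α : Fin N → ℤ) : ℤ :=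
  ∏ i : Fin N, ∏ j ∈ Finset.Ioi i, (α i - α j)

/-! Write `N = 2 * m + 2`. The exponent `N + 1` is odd, so the matrix is alternating and `S` is a
square. Modulo `p` each `α i` is an `N`-th root of unity, so the binomial expansion of `(x - y) ^ (N
+ 1)` folds to exponents below `N`. The matrix becomes `V * J * Vᵀ`, with `V` Vandermonde and `J` a
block matrix `0, D, -D, 0` with `D` diagonal (`det_sub_pow_of_pow_eq_one`). Hence `√S ≡ ± det D *
T`. In both cases `p ≡ 1 (mod 4)`, so the sign does not affect the Legendre symbol. The symbol of
`det D`, a product of binomial coefficients and `N + 2`, reduces to factorials and then to a double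
factorial; `k * N ≡ -1` rewrites what remains in terms of `k`, and the parity of `m` separates (a)
from (b). -/

/-! ### Alternating determinants -/

/-- The determinant of an alternating matrix over a field is a square. -/
theorem isSquare_det_of_alternating {K : Type*} [Field K] (n : ℕ) :
    ∀ {ι : Type} [Fintype ι] [DecidableEq ι] (A : Matrix ι ι K), Fintype.card ι = n →
      A.transpose = -A → (∀ i, A i i = 0) → IsSquare A.det := by
  induction n using Nat.strong_induction_on with
  | _ n ih =>
  intro ι _ _ A hn hA hd
  by_cases h0 : A = 0
  · subst h0
    rcases isEmpty_or_nonempty ι with h | h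
    · simp
    · simp [Matrix.det_zero]
  obtain ⟨i, j, hij⟩ : ∃ i j, A i j ≠ 0 := by
    by_contra! h
    exact h0 (by ext i j; simp [h i j])
  have hne : i ≠ j := fun h => hij (by rw [h, hd])
  have hskew : ∀ a b, A a b = -A b a := fun a b => by
    have := congrFun (congrFun hA b) a
    simpa using this
  classical
  let f : Fin 2 → ι := ![i, j]
  have hf : Function.Injective f := by
    intro a b
    fin_cases a <;> fin_cases b <;> simp [f, hne, hne.symm]
  let e : Fin 2 ⊕ ↥((Set.range f)ᶜ) ≃ ι :=
    ((Equiv.ofInjective f hf).sumCongr (Equiv.refl _)).trans (Equiv.Set.sumCompl (Set.range f))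
  let B := A.submatrix e e
  have hB : B.det = A.det := Matrix.det_submatrix_equiv_self e A
  have hBs : ∀ a b, B a b = -B b a := fun a b => hskew _ _
  have he0 : e (Sum.inl 0) = i := rfl
  have he1 : e (Sum.inl 1) = j := rfl
  have hdet : B.toBlocks₁₁.det = A i j ^ 2 := by
    rw [Matrix.det_fin_two]
    simp only [Matrix.toBlocks₁₁, Matrix.of_apply, B, Matrix.submatrix_apply, he0, he1, hd]
    rw [hskew j i]
    ring
  have hunit : IsUnit B.toBlocks₁₁.det := by
    rw [hdet]
    exact (pow_ne_zero 2 hij).isUnit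
  -- Induct on the Schur complement of this block, which is again alternating.
  have : Invertible B.toBlocks₁₁ := B.toBlocks₁₁.invertibleOfIsUnitDet hunit
  rw [← hB, ← Matrix.fromBlocks_toBlocks B, Matrix.det_fromBlocks₁₁, hdet]
  refine (IsSquare.sq _).mul ?_
  have h11 : B.toBlocks₁₁.transpose = -B.toBlocks₁₁ := by
    ext a b; exact hBs _ _
  have h22 : B.toBlocks₂₂.transpose = -B.toBlocks₂₂ := by
    ext a b; exact hBs _ _
  have h12 : B.toBlocks₁₂.transpose = -B.toBlocks₂₁ := by
    ext a b; exact hBs _ _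
  have h21 : B.toBlocks₂₁ = -B.toBlocks₁₂.transpose := by
    rw [h12, neg_neg]
  have hinv : (B.toBlocks₁₁⁻¹).transpose = -B.toBlocks₁₁⁻¹ := by
    rw [Matrix.transpose_nonsing_inv, h11]
    refine Matrix.inv_eq_left_inv ?_
    rw [neg_mul_neg, Matrix.nonsing_inv_mul _ hunit]
  -- In characteristic 2 skewness does not force a zero diagonal, so the diagonal of the Schur
  -- complement needs this separately.
  have halt : ∀ v : Fin 2 → K, v ⬝ᵥ (B.toBlocks₁₁⁻¹.mulVec v) = 0 := by
    have h01 := congrFun (congrFun hinv 0) 1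
    have hdiag : ∀ a, B.toBlocks₁₁⁻¹ a a = 0 := by
      intro a
      rw [Matrix.inv_def, Matrix.adjugate_fin_two]
      fin_cases a <;> simp [Matrix.toBlocks₁₁, B, hd]
    simp only [Matrix.transpose_apply, Matrix.neg_apply] at h01
    intro v
    simp only [dotProduct, Matrix.mulVec, Fin.sum_univ_two, hdiag, h01]
    ring
  refine ih (Fintype.card ↥((Set.range f)ᶜ)) ?_ _ rfl ?_ ?_
  · have := Fintype.card_congr e
    rw [Fintype.card_sum, Fintype.card_fin] at this
    omega
  · rw [Matrix.invOf_eq_nonsing_inv, Matrix.transpose_sub, Matrix.transpose_mul,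
      Matrix.transpose_mul, hinv, h22, h12, h21]
    simp only [Matrix.transpose_transpose, Matrix.mul_neg, Matrix.neg_mul, Matrix.transpose_neg,
      Matrix.mul_assoc, neg_neg]
    abel
  · intro a
    rw [Matrix.invOf_eq_nonsing_inv, h21, Matrix.sub_apply]
    have h1 : B.toBlocks₂₂ a a = 0 := hd _
    have h2 := halt (fun b => B.toBlocks₁₂ b a)
    rw [h1, zero_sub, neg_eq_zero, Matrix.mul_assoc, Matrix.neg_mul, Matrix.neg_apply, neg_eq_zero,
      Matrix.mul_apply]
    exact h2

/-! ### Folding the binomial expansion at roots of unity -/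

theorem Matrix.det_fromBlocks_zero_neg {n R : Type*} [Fintype n] [DecidableEq n] [CommRing R]
    (D : Matrix n n R) : (Matrix.fromBlocks 0 D (-D) 0).det = D.det ^ 2 := by
  -- The quarter turn is a product of three shears, each of determinant 1.
  have h : Matrix.fromBlocks 0 D (-D) 0 =
      Matrix.fromBlocks D 0 0 D * (Matrix.fromBlocks 1 1 0 1 *
        Matrix.fromBlocks 1 0 (-1) 1 * Matrix.fromBlocks 1 1 0 1) := by
    simp [Matrix.fromBlocks_multiply]
  rw [h]
  simp [Matrix.det_mul, sq]

@[to_additive]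
theorem Finset.prod_range_even_eq_prod_reflect {M : Type*} [CommMonoid M] (m : ℕ)
    (f : ℕ → M) :
    ∏ t ∈ Finset.range (2 * m), f t = ∏ t ∈ Finset.range m, (f t * f (2 * m - 1 - t)) := by
  rw [two_mul, Finset.prod_range_add, Finset.prod_mul_distrib]
  congr 1
  refine Finset.prod_nbij' (fun t => m - 1 - t) (fun t => m - 1 - t) ?_ ?_ ?_ ?_ ?_ <;>
    intro t ht <;> rw [Finset.mem_range] at ht
  · simp only [Finset.mem_range]; omega
  · simp only [Finset.mem_range]; omega
  · omega
  · omega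
  · congr 1; omega

/-- One exponent from each complementary pair when folding `(x - y) ^ (2 * m + 3)` modulo
`x ^ (2 * m + 2) = y ^ (2 * m + 2) = 1`; see `sub_pow_eq_sum_of_pow_eq_one`. -/
def foldLeft (m : ℕ) : Fin (m + 1) → ℕ := Fin.cons 1 fun t => t + 2

/-- The exponents complementary to those of `foldLeft`. -/
def foldRight (m : ℕ) : Fin (m + 1) → ℕ := Fin.cons 0 fun t => 2 * m + 1 - t

/-- The coefficients of the folded expansion of `(x - y) ^ (2 * m + 3)`. -/
def foldCoeff (R : Type*) [CommRing R] (m : ℕ) : Fin (m + 1) → R :=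
  Fin.cons (2 * m + 4) fun t => (-1) ^ ((t : ℕ) + 1) * ((2 * m + 3).choose (t + 2) : R)

/-- Terms of exponent `s` and `2 * m + 3 - s` pair up with opposite signs. The pairs `s = 0` and `s
= 1` both reduce to `x - y`, which gives the coefficient `1 + (2 * m + 3)`. -/
theorem sub_pow_eq_sum_of_pow_eq_one {R : Type*} [CommRing R] (m : ℕ) {x y : R}
    (hx : x ^ (2 * m + 2) = 1) (hy : y ^ (2 * m + 2) = 1) :
    (x - y) ^ (2 * m + 3) = ∑ t, foldCoeff R m t *
      (x ^ foldLeft m t * y ^ foldRight m t - x ^ foldRight m t * y ^ foldLeft m t) := by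
  have hx' : x ^ (2 * m + 3) = x := by rw [pow_succ, hx, one_mul]
  have hy' : y ^ (2 * m + 3) = y := by rw [pow_succ, hy, one_mul]
  rw [sub_pow, show 2 * m + 3 + 1 = 2 * (m + 2) by ring,
    Finset.sum_range_even_eq_sum_reflect, Finset.sum_range_succ', Finset.sum_range_succ',
    Fin.sum_univ_succ, add_assoc, add_comm, Finset.sum_range]
  congr 1
  · have h1 : (-1 : R) ^ (2 * m + 3) = -1 := Odd.neg_one_pow ⟨m + 1, by ring⟩
    have h2 : (-1 : R) ^ (2 * m + 2) = 1 := Even.neg_one_pow ⟨m + 1, by ring⟩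
    have e1 : 2 * (m + 2) - 1 - 0 = 2 * m + 3 := by omega
    have e2 : 2 * (m + 2) - 1 - (0 + 1) = 2 * m + 2 := by omega
    have e3 : 2 * m + 3 - (2 * m + 2) = 1 := by omega
    have e4 : 2 * m + 3 - (0 + 1) = 2 * m + 2 := by omega
    have c1 : (2 * m + 3).choose (2 * m + 2) = 2 * m + 3 := Nat.choose_succ_self_right _
    have h3 : (-1 : R) ^ (2 * m + 3 + (2 * m + 3)) = 1 := Even.neg_one_pow ⟨_, rfl⟩
    have h4 : (-1 : R) ^ (2 * m + 2 + (2 * m + 3)) = -1 := by rw [pow_add, h1, h2]; ring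
    have h5 : (-1 : R) ^ (1 + (2 * m + 3)) = 1 := by rw [pow_add, h1]; ring
    simp only [e1, e2, e3, e4, foldCoeff, foldLeft, foldRight, Fin.cons_zero, c1, zero_add, h1, h3,
      h4, h5, hx, hy, hx', hy', Nat.sub_self, Nat.sub_zero, Nat.choose_self, Nat.choose_zero_right,
      Nat.choose_one_right, pow_zero, pow_one]
    push_cast
    ring
  · refine Finset.sum_congr rfl fun t _ => ?_
    have ht : (t : ℕ) < m := t.2
    have e1 : 2 * (m + 2) - 1 - ((t : ℕ) + 1 + 1) = 2 * m + 1 - t := by omega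
    have e2 : 2 * m + 3 - ((t : ℕ) + 1 + 1) = 2 * m + 1 - t := by omega
    have e3 : 2 * m + 3 - (2 * m + 1 - (t : ℕ)) = t + 2 := by omega
    have c1 : (2 * m + 3).choose (2 * m + 1 - t) = (2 * m + 3).choose (t + 2) := by
      rw [← Nat.choose_symm (show (t : ℕ) + 2 ≤ 2 * m + 3 by omega)]
      congr 1
      omega
    have h1 : (-1 : R) ^ ((t : ℕ) + 1 + 1 + (2 * m + 3)) = (-1) ^ ((t : ℕ) + 1) := by
      rw [show (t : ℕ) + 1 + 1 + (2 * m + 3) = (t + 1) + 2 * (m + 2) by ring, pow_add, pow_mul]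
      simp
    have h2 : (-1 : R) ^ (2 * m + 1 - t + (2 * m + 3)) = -(-1) ^ ((t : ℕ) + 1) := by
      have : 2 * m + 1 - t + (2 * m + 3) + 2 * (t + 1) = (t + 1) + 1 + 2 * (2 * m + 2) := by omega
      have h := congrArg (fun a => (-1 : R) ^ a) this
      simp only [pow_add _ _ (2 * _), pow_mul, neg_one_sq, one_pow, mul_one] at h
      rw [h, pow_succ]
      ring
    simp only [e1, e2, e3, foldCoeff, foldLeft, foldRight, Fin.cons_succ, c1, h1, h2]
    ring

/-- The exponents of the folded expansion run through all residues modulo `2 * m + 2`. -/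
noncomputable def foldEquiv (m : ℕ) : Fin (m + 1) ⊕ Fin (m + 1) ≃ Fin (2 * m + 2) :=
  Equiv.ofBijective
    (Sum.elim
      (fun t => ⟨foldLeft m t, by
        refine Fin.cases ?_ (fun i => ?_) t <;> simp [foldLeft]; omega⟩)
      (fun t => ⟨foldRight m t, by
        refine Fin.cases ?_ (fun i => ?_) t <;> simp [foldRight]; omega⟩))
    (by
      rw [Fintype.bijective_iff_injective_and_card]
      refine ⟨?_, by simp; ring⟩
      rintro (a | a) (b | b) <;> refine Fin.cases ?_ (fun a => ?_) a <;>
        refine Fin.cases ?_ (fun b => ?_) b <;>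
        simp [foldLeft, foldRight, Fin.ext_iff] <;> omega)

/-- The determinant of `(v i - v j) ^ (2 * m + 3)` for `2 * m + 2` roots of unity of that order. -/
theorem det_sub_pow_of_pow_eq_one {R : Type*} [CommRing R] (m : ℕ) (v : Fin (2 * m + 2) → R)
    (hv : ∀ i, v i ^ (2 * m + 2) = 1) :
    (Matrix.of fun i j => (v i - v j) ^ (2 * m + 3)).det =
      ((∏ t, foldCoeff R m t) * (Matrix.vandermonde v).det) ^ 2 := by
  let e := foldEquiv m
  let V : Matrix (Fin (m + 1) ⊕ Fin (m + 1)) (Fin (m + 1) ⊕ Fin (m + 1)) R :=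
    (Matrix.vandermonde v).submatrix e e
  let D : Matrix (Fin (m + 1)) (Fin (m + 1)) R := Matrix.diagonal (foldCoeff R m)
  -- Using `e` for rows and columns alike leaves every determinant unchanged, so no permutation sign
  -- arises.
  have hM : (Matrix.of fun i j => (v i - v j) ^ (2 * m + 3)).submatrix e e =
      V * Matrix.fromBlocks 0 D (-D) 0 * V.transpose := by
    ext i j
    have hl : ∀ t, (e (Sum.inl t) : ℕ) = foldLeft m t := fun _ => rfl
    have hr : ∀ t, (e (Sum.inr t) : ℕ) = foldRight m t := fun _ => rfl
    simp only [Matrix.submatrix_apply, Matrix.of_apply,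
      sub_pow_eq_sum_of_pow_eq_one m (hv (e i)) (hv (e j)), Matrix.mul_apply, Fintype.sum_sum_type,
      Matrix.transpose_apply, V, D, Matrix.vandermonde_apply, Matrix.fromBlocks_apply₁₁,
      Matrix.fromBlocks_apply₁₂, Matrix.fromBlocks_apply₂₁, Matrix.fromBlocks_apply₂₂, hl, hr,
      Matrix.zero_apply, Matrix.neg_apply, Matrix.diagonal_apply, mul_neg, mul_ite, mul_zero,
      Finset.sum_neg_distrib, Finset.sum_ite_eq', Finset.mem_univ, if_true, zero_add,
      add_zero, Finset.sum_const_zero, neg_mul]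
    rw [← Finset.sum_neg_distrib, ← Finset.sum_add_distrib]
    exact Finset.sum_congr rfl fun t _ => by ring
  rw [← Matrix.det_submatrix_equiv_self e, hM, Matrix.det_mul, Matrix.det_mul,
    Matrix.det_fromBlocks_zero_neg, Matrix.det_transpose, Matrix.det_submatrix_equiv_self,
    Matrix.det_diagonal]
  ring

/-! ### From integers to fields -/

theorem isSquare_residueDet {N m : ℕ} (hm : Odd m) (α : Fin N → ℤ) :
    IsSquare (residueDet m (-1) α) := by
  -- An integer that is a rational square is an integer square, so the field `ℚ` suffices.
  rw [← Rat.isSquare_intCast_iff, residueDet, ← eq_intCast (Int.castRingHom ℚ), RingHom.map_det]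
  refine isSquare_det_of_alternating N _ (Fintype.card_fin N) ?_ ?_
  · ext i j
    simp only [RingHom.mapMatrix_apply, Matrix.transpose_apply, Matrix.map_apply, Matrix.of_apply,
      Matrix.neg_apply, ← map_neg, ← hm.neg_pow]
    congr 2
    ring
  · intro i
    simp [hm.pos.ne']

theorem IsPowerResidue.pow_eq_one {p k n : ℕ} [Fact p.Prime] (hn : p - 1 = k * n) {x : ℤ}
    (hx : IsPowerResidue p k x) : (x : ZMod p) ^ n = 1 := by
  obtain ⟨hx0, y, hy⟩ := hx
  have hy' : (y : ZMod p) ^ k = x := by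
    have := (ZMod.intCast_eq_intCast_iff _ _ p).2 hy
    simpa using this
  have hx1 : (x : ZMod p) ≠ 0 := by
    rwa [Ne, ZMod.intCast_zmod_eq_zero_iff_dvd]
  have hk : k ≠ 0 := by
    rintro rfl
    have := (Fact.out : p.Prime).two_le
    omega
  have hy0 : (y : ZMod p) ≠ 0 := by
    intro h
    rw [h, zero_pow hk] at hy'
    exact hx1 hy'.symm
  rw [← hy', ← pow_mul, ← hn, ZMod.pow_card_sub_one_eq_one hy0]

theorem sq_det_vandermonde_eq_sq_diffProd {R : Type*} [CommRing R] {N : ℕ} (α : Fin N → ℤ) :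
    (Matrix.vandermonde fun i => (α i : R)).det ^ 2 = (diffProd α : R) ^ 2 := by
  rw [Matrix.det_vandermonde, diffProd]
  push_cast
  simp only [← Finset.prod_pow]
  exact Finset.prod_congr rfl fun i _ => Finset.prod_congr rfl fun j _ => by ring

/-! ### Quadratic characters of the coefficients -/

section QuadraticChar

variable {p : ℕ} [Fact p.Prime]

theorem quadraticChar_eq_of_sq_eq {F : Type*} [Field F] [Fintype F] [DecidableEq F]
    (h1 : quadraticChar F (-1) = 1) {a b : F} (h : a ^ 2 = b ^ 2) :
    quadraticChar F a = quadraticChar F b := by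
  rcases sq_eq_sq_iff_eq_or_eq_neg.1 h with rfl | rfl
  · rfl
  · rw [neg_eq_neg_one_mul, map_mul, h1, one_mul]

theorem ZMod.factorial_ne_zero_of_lt {n : ℕ} (h : n < p) : (n ! : ZMod p) ≠ 0 := by
  rw [Ne, ZMod.natCast_eq_zero_iff, (Fact.out : p.Prime).dvd_factorial]
  omega

/-- The character is `±1` on nonzero elements, so dividing by factorials amounts to multiplying by
them. -/
theorem quadraticChar_choose {n s : ℕ} (hn : n < p) (hs : s ≤ n) :
    quadraticChar (ZMod p) (n.choose s) =
      quadraticChar (ZMod p) n ! *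
        (quadraticChar (ZMod p) s ! * quadraticChar (ZMod p) (n - s)!) := by
  have h := Nat.choose_mul_factorial_mul_factorial hs
  have h1 := quadraticChar_sq_one (ZMod.factorial_ne_zero_of_lt (hs.trans_lt hn))
  have h2 := quadraticChar_sq_one
    (ZMod.factorial_ne_zero_of_lt (p := p) ((Nat.sub_le n s).trans_lt hn))
  rw [← h]
  push_cast
  rw [map_mul, map_mul]
  linear_combination (-quadraticChar (ZMod p) (n.choose s)) * (h1 + quadraticChar (ZMod p) s ! ^ 2 * h2)

/-- Consecutive factorials combine: `(2j)! * (2j+1)!` is a square times `2j + 1`. -/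
theorem prod_quadraticChar_factorial (m : ℕ) (hm : 2 * m + 1 < p) :
    ∏ t ∈ Finset.range (2 * m), quadraticChar (ZMod p) ((t + 2)! : ℕ) =
      quadraticChar (ZMod p) ((2 * m + 1)‼ : ℕ) := by
  induction m with
  | zero => simp
  | succ m ih =>
    have h := quadraticChar_sq_one
      (ZMod.factorial_ne_zero_of_lt (p := p) (show 2 * m + 2 < p by omega))
    rw [show 2 * (m + 1) = 2 * m + 1 + 1 by ring, Finset.prod_range_succ, Finset.prod_range_succ,
      ih (by omega), show 2 * m + 1 + 2 = (2 * m + 2) + 1 by ring, Nat.factorial_succ (2 * m + 2),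
      show 2 * m + 1 + 1 + 1 = (2 * m + 1) + 2 by ring, Nat.doubleFactorial_add_two]
    push_cast
    rw [show (2 * m + 1 + 2 : ZMod p) = 2 * m + 2 + 1 by ring, map_mul, map_mul]
    linear_combination quadraticChar (ZMod p) ((2 * m + 1)‼ : ℕ) *
      quadraticChar (ZMod p) (2 * m + 2 + 1) * h

theorem quadraticChar_prod_foldCoeff (h1 : quadraticChar (ZMod p) (-1) = 1) (m : ℕ)
    (hm : 2 * m + 3 < p) :
    quadraticChar (ZMod p) (∏ t, foldCoeff (ZMod p) m t) =
      quadraticChar (ZMod p) (2 * m + 4) *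
        (quadraticChar (ZMod p) ((2 * m + 3)! : ℕ) ^ m *
          quadraticChar (ZMod p) ((2 * m + 1)‼ : ℕ)) := by
  rw [Fin.prod_univ_succ, map_mul, map_prod]
  simp only [foldCoeff, Fin.cons_zero, Fin.cons_succ, map_mul, map_pow, h1, one_pow, one_mul]
  -- The denominators `(t + 2)! * (2 * m + 1 - t)!`, for `t < m`, run once through `2!, …, (2 * m +
  -- 1)!`.
  rw [← Finset.prod_range fun t : ℕ => quadraticChar (ZMod p) ((2 * m + 3).choose (t + 2) : ℕ),
    ← prod_quadraticChar_factorial m (by omega),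
    Finset.prod_range_even_eq_prod_reflect]
  have : ∀ t ∈ Finset.range m, quadraticChar (ZMod p) ((2 * m + 3).choose (t + 2) : ℕ) =
      quadraticChar (ZMod p) ((2 * m + 3)! : ℕ) * (quadraticChar (ZMod p) ((t + 2)! : ℕ) *
        quadraticChar (ZMod p) ((2 * m - 1 - t + 2)! : ℕ)) := fun t ht => by
    rw [Finset.mem_range] at ht
    rw [quadraticChar_choose hm (by omega), show 2 * m + 3 - (t + 2) = 2 * m - 1 - t + 2 by omega]
  rw [Finset.prod_congr rfl this, Finset.prod_mul_distrib, Finset.prod_const, Finset.card_range]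

theorem quadraticChar_sqrt_residueDet {k : ℕ} (h1 : quadraticChar (ZMod p) (-1) = 1) (m : ℕ)
    (hk : 2 ≤ k) (hN : p - 1 = k * (2 * m + 2)) (α : Fin (2 * m + 2) → ℤ)
    (hα : ∀ i, IsPowerResidue p k (α i)) {r : ℤ}
    (hr : r ^ 2 = residueDet (2 * m + 3) (-1) α) :
    quadraticChar (ZMod p) r =
      quadraticChar (ZMod p) (k * (2 * k - 1)) *
        (quadraticChar (ZMod p) ((2 * m + 3)! : ℕ) ^ m *
          quadraticChar (ZMod p) ((2 * m + 1)‼ : ℕ)) * quadraticChar (ZMod p) (diffProd α) := by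
  have hp2 := (Fact.out : p.Prime).two_le
  have hlt : 2 * m + 3 < p := by nlinarith [Nat.sub_add_cancel (show 1 ≤ p by omega)]
  have hkp : k < p := by nlinarith [Nat.sub_add_cancel (show 1 ≤ p by omega)]
  have hk0 : (k : ZMod p) ≠ 0 := by
    rw [Ne, ZMod.natCast_eq_zero_iff]
    exact Nat.not_dvd_of_pos_of_lt (by omega) hkp
  have hkN : (k : ZMod p) * (2 * m + 2) = -1 := by
    have : k * (2 * m + 2) + 1 = p := by omega
    have := congrArg (Nat.cast : ℕ → ZMod p) this
    push_cast at this
    rw [ZMod.natCast_self] at this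
    linear_combination this
  have hsq : (r : ZMod p) ^ 2 = ((∏ t, foldCoeff (ZMod p) m t) * (diffProd α : ZMod p)) ^ 2 := by
    have h := det_sub_pow_of_pow_eq_one m (fun i => (α i : ZMod p)) fun i => (hα i).pow_eq_one hN
    rw [mul_pow, sq_det_vandermonde_eq_sq_diffProd, ← mul_pow] at h
    rw [← h, ← Int.cast_pow, hr, residueDet, ← eq_intCast (Int.castRingHom (ZMod p)), RingHom.map_det]
    congr 1
    ext i j
    simp [sub_eq_add_neg]
  have hc : quadraticChar (ZMod p) (2 * m + 4) = quadraticChar (ZMod p) (k * (2 * k - 1)) := by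
    rw [show (k : ZMod p) * (2 * k - 1) = k ^ 2 * (2 * m + 4) by linear_combination -k * hkN,
      map_mul, quadraticChar_sq_one' hk0, one_mul]
  rw [quadraticChar_eq_of_sq_eq h1 hsq, map_mul, quadraticChar_prod_foldCoeff h1 m hlt, hc]

end QuadraticChar

/-! ### The two congruence cases -/

theorem theorem1p3 (p k : ℕ) [Fact p.Prime] (hp : Odd p) (hk : 2 ≤ k) (hkp : k ≤ (p - 1) / 2)
    (hmod : p ≡ 1 [MOD 2 * k]) (α : Fin ((p - 1) / k) → ℤ)
    (hα : AreDistinctPowerResidues p k α) :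
    IsSquare (residueDet (1 + (p - 1) / k) (-1) α) ∧
    ∀ r : ℤ, r ^ 2 = residueDet (1 + (p - 1) / k) (-1) α →
      (p ≡ 1 [MOD 4 * k] →
        legendreSym p r =
          legendreSym p (((k : ℤ) - 1) * (2 * (k : ℤ) - 1)) *
            legendreSym p ((((p - 1) / k)‼ : ℕ) : ℤ) * legendreSym p (diffProd α)) ∧
      (Even k → p ≡ 2 * k + 1 [MOD 4 * k] →
        (p = 2 * k + 1 → legendreSym p r = legendreSym p (diffProd α)) ∧
        (p ≠ 2 * k + 1 →
          legendreSym p r =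
            legendreSym p ((k : ℤ) * (2 * (k : ℤ) - 1)) *
              legendreSym p ((((p - 1) / k - 1)‼ : ℕ) : ℤ) * legendreSym p (diffProd α))) := by
  have hp2 := (Fact.out : p.Prime).two_le
  obtain ⟨c, hc⟩ : 2 * k ∣ p - 1 := (Nat.modEq_iff_dvd' (by omega)).1 hmod.symm
  obtain ⟨m, rfl⟩ : ∃ m, c = m + 1 := Nat.exists_eq_succ_of_ne_zero (by
    rintro rfl
    omega)
  have hN : p - 1 = k * (2 * m + 2) := by rw [hc]; ring
  have hdiv : (p - 1) / k = 2 * m + 2 := by rw [hN, Nat.mul_div_cancel_left _ (by omega)]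
  obtain ⟨hα, -⟩ := hα
  revert α
  rw [hdiv, show 1 + (2 * m + 2) = 2 * m + 3 by ring]
  intro α hα
  refine ⟨isSquare_residueDet ⟨m + 1, by ring⟩ α, fun r hr => ?_⟩
  have hkp' : k < p := by omega
  have hlt : 2 * m + 3 < p := by nlinarith [Nat.sub_add_cancel (show 1 ≤ p by omega)]
  have hk0 : (k : ZMod p) ≠ 0 := by
    rw [Ne, ZMod.natCast_eq_zero_iff]
    exact Nat.not_dvd_of_pos_of_lt (by omega) hkp'
  have hkN : (k : ZMod p) * (2 * m + 2) = -1 := by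
    have : k * (2 * m + 2) + 1 = p := by omega
    have := congrArg (Nat.cast : ℕ → ZMod p) this
    push_cast at this
    rw [ZMod.natCast_self] at this
    linear_combination this
  have hneg : p % 4 = 1 → quadraticChar (ZMod p) (-1) = 1 := fun h => by
    have := legendreSym.at_neg_one (p := p) (by omega)
    rw [ZMod.χ₄_nat_one_mod_four h, legendreSym] at this
    simpa using this
  simp only [legendreSym]
  push_cast
  refine ⟨fun h4 => ?_, fun hke h4 => ?_⟩
  · obtain ⟨d, hd⟩ : 4 * k ∣ p - 1 := (Nat.modEq_iff_dvd' (by omega)).1 h4.symm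
    have hmd : m + 1 = 2 * d :=
      Nat.eq_of_mul_eq_mul_left (show 0 < 2 * k by omega) (by rw [← hc, hd]; ring)
    have hmo : Odd m := ⟨d - 1, by omega⟩
    have hp4 : p % 4 = 1 := by
      have : p - 1 = 4 * (k * d) := by rw [hd]; ring
      omega
    rw [quadraticChar_sqrt_residueDet (hneg hp4) m hk hN α hα hr]
    obtain ⟨q, hq⟩ := hmo
    have hf := quadraticChar_sq_one (ZMod.factorial_ne_zero_of_lt (p := p) hlt)
    -- As `m` is odd, one factor `(N + 1)! = (N + 1) * N‼ * (N - 1)‼` survives; its `(N - 1)‼`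
    -- cancels the one already present.
    have hpow : quadraticChar (ZMod p) ((2 * m + 3)! : ℕ) ^ m =
        quadraticChar (ZMod p) ((2 * m + 3)! : ℕ) := by
      nth_rewrite 2 [hq]
      rw [pow_succ, pow_mul, hf, one_pow, one_mul]
    have hdf : quadraticChar (ZMod p) ((2 * m + 1)‼ : ℕ) ^ 2 = 1 := by
      refine quadraticChar_sq_one fun h0 => ?_
      have := ZMod.factorial_ne_zero_of_lt (p := p) (show 2 * m + 2 < p by omega)
      rw [Nat.factorial_eq_mul_doubleFactorial (2 * m + 1)] at this
      push_cast at this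
      exact this (by rw [h0, mul_zero])
    have hk1 : quadraticChar (ZMod p) (2 * m + 3) * quadraticChar (ZMod p) k =
        quadraticChar (ZMod p) (k - 1) := by
      rw [← map_mul]
      congr 1
      linear_combination hkN
    have hk2 := quadraticChar_sq_one hk0
    rw [hpow, Nat.factorial_succ (2 * m + 2), Nat.factorial_eq_mul_doubleFactorial (2 * m + 1)]
    push_cast
    rw [show (2 * m + 2 + 1 : ZMod p) = 2 * m + 3 by ring]
    simp only [map_mul]
    rw [← hk1]
    linear_combination quadraticChar (ZMod p) k * quadraticChar (ZMod p) (2 * k - 1) *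
      quadraticChar (ZMod p) (2 * m + 3) * quadraticChar (ZMod p) ((2 * m + 1 + 1)‼ : ℕ) *
      quadraticChar (ZMod p) (diffProd α) * hdf
  · have hme : Even m := by
      have hle : 2 * k + 1 ≤ p := by omega
      obtain ⟨d, hd⟩ := (Nat.modEq_iff_dvd' hle).1 h4.symm
      refine ⟨d, Nat.eq_of_mul_eq_mul_left (show 0 < 2 * k by omega) ?_⟩
      have : 2 * k * (m + 1) = 2 * k * m + 2 * k := by ring
      have : 2 * k * (d + d) = 4 * k * d := by ring
      omega
    obtain ⟨h, rfl⟩ := hke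
    have hp4 : p % 4 = 1 := by
      have : p - 1 = 4 * (h * (m + 1)) := by rw [hN]; ring
      omega
    have key := quadraticChar_sqrt_residueDet (hneg hp4) m hk hN α hα hr
    obtain ⟨q, hq⟩ := hme
    have hf := quadraticChar_sq_one (ZMod.factorial_ne_zero_of_lt (p := p) hlt)
    have hpow : quadraticChar (ZMod p) ((2 * m + 3)! : ℕ) ^ m = 1 := by
      nth_rewrite 2 [hq]
      rw [← two_mul, pow_mul, hf, one_pow]
    rw [hpow, one_mul] at key
    push_cast at key
    refine ⟨fun h2k => ?_, fun _ => by exact_mod_cast key⟩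
    have hm0 : m = 0 := by
      have : 2 * m + 2 = 2 := Nat.eq_of_mul_eq_mul_left (show 0 < h + h by omega) (by omega)
      omega
    subst hm0
    -- The general formula still holds here: `2 * k ≡ -1` gives `k * (2 * k - 1) ≡ 1`, and the
    -- double factorial is `1‼`.
    have hone : ((h : ZMod p) + h) * (2 * (h + h) - 1) = 1 := by
      push_cast at hkN
      linear_combination ((h : ZMod p) + h - 1) * hkN
    rw [key, hone]
    simp
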